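/- Let $G$ be a compact Hausdorff group with normalized Haar measure $m_G$, and let $(\Phi,\Psi)$ be a pair of complementary Young functions, both satisfying the $\Delta_2$-condition. (A Young function is a convex function $\Phi:[0,\infty]\to[0,\infty]$ with $\Phi(0)=0$ and $\lim_{x\to\infty}\Phi(x)=\infty$; its complementary function is $\Psi(y)=\sup_{x\ge 0}(xy-\Phi(x))$; the $\Delta_2$-condition says that there are $K>0$ and $x_0>0$ with $\Phi(2x)\le K\Phi(x)$ for all $x\ge x_0$.) Let $L^\Phi(G)$ be the Orlicz space of (classes of) complex measurable functions $f$ on $G$ with finite Luxemburg norm $$\|f\|_\Phi=\inf\Bigl\{k>0:\int_G\Phi\bigl(|f|/k\bigr)\,dm_G\le 1\Bigr\}.$$ Let $\mu\in M(G)$ be a bounded complex Radon measure on $G$, and for a Borel set $A\subseteq G$ let $\nu_{\Phi,\mu}(A)=\mu*\chi_A\in L^\Phi(G)$, where $(\mu*\chi_A)(t)=\int_G\chi_A(s^{-1}t)\,d\mu(s)$. Suppose that there is a Bochner-integrable function $F:G\to L^\Phi(G)$ such that $\nu_{\Phi,\mu}(A)=\int_A F\,dm_G$ for every Borel set $A\subseteq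 G$. Then there exists $f\in L^\Phi(G)$ such that $d\mu=f\,dm_G$, i.e. $f$ is $m_G$-integrable and $\mu(A)=\int_A f\,dm_G$ for every Borel set $A\subseteq G$. -/

import Mathlib

open MeasureTheory Filter Topology
open scoped ENNReal NNReal

noncomputable section

/-- A Young function: a convex function `Φ : [0,∞] → [0,∞]` with `Φ 0 = 0` and `Φ x → ∞` as
`x → ∞`. The value `∞` is allowed. -/
structure YoungFunction where
  toFun : ℝ≥0∞ → ℝ≥0∞
  convexOn' : ConvexOn ℝ≥0 Set.univ toFun
  map_zero' : toFun 0 = 0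
  tendsto_top' : Tendsto toFun (𝓝 ∞) (𝓝 ∞)

namespace YoungFunction

instance : CoeFun YoungFunction (fun _ => ℝ≥0∞ → ℝ≥0∞) := ⟨toFun⟩

/-- `Ψ` is the complementary function of `Φ`: `Ψ y = sup {x y - Φ x : x ≥ 0}` for `0 ≤ y < ∞`.
The subtraction is truncated at `0`, which does not change the supremum, since `x = 0`
contributes `0`. -/
def IsComplementary (Φ Ψ : YoungFunction) : Prop :=
  ∀ y : ℝ≥0, Ψ y = ⨆ x : ℝ≥0, ((x : ℝ≥0∞) * y - Φ x)

/-- The `Δ₂`-condition: `Φ (2 x) ≤ K Φ x` for all `x ≥ x₀`, for some `K > 0` and `x₀ > 0`. -/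
def DeltaTwo (Φ : YoungFunction) : Prop :=
  ∃ K x₀ : ℝ≥0, 0 < K ∧ 0 < x₀ ∧ ∀ x : ℝ≥0, x₀ ≤ x → Φ (2 * x) ≤ K * Φ x

theorem apply_zero (Φ : YoungFunction) : Φ 0 = 0 := Φ.map_zero'

theorem map_smul_le (Φ : YoungFunction) {a : ℝ≥0} (ha : a ≤ 1) (x : ℝ≥0∞) :
    Φ (a * x) ≤ a * Φ x := by
  have h := Φ.convexOn'.2 (Set.mem_univ x) (Set.mem_univ 0) zero_le zero_le
    (add_tsub_cancel_of_le ha)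
  simpa [Φ.apply_zero, ENNReal.smul_def] using h

theorem convex_le (Φ : YoungFunction) {a b : ℝ≥0} (hab : a + b = 1) (x y : ℝ≥0∞) :
    Φ (a * x + b * y) ≤ a * Φ x + b * Φ y := by
  have h := Φ.convexOn'.2 (Set.mem_univ x) (Set.mem_univ y) zero_le zero_le hab
  simpa [ENNReal.smul_def] using h

theorem apply_top (Φ : YoungFunction) : Φ ∞ = ∞ := by
  by_contra h
  have h1 := Φ.tendsto_top'.eventually (lt_mem_nhds (lt_top_iff_ne_top.2 h))
  exact lt_irrefl _ h1.self_of_nhds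

theorem mono (Φ : YoungFunction) : Monotone Φ := by
  intro x y hxy
  rcases eq_or_ne y ∞ with rfl | hy
  · rw [Φ.apply_top]; exact le_top
  rcases eq_or_ne y 0 with rfl | hy0
  · rw [le_antisymm hxy zero_le]
  have hx : x ≠ ∞ := ne_top_of_le_ne_top hy hxy
  have hle : x / y ≤ 1 := ENNReal.div_le_of_le_mul (by simpa using hxy)
  have hne : x / y ≠ ∞ := ne_top_of_le_ne_top ENNReal.one_ne_top hle
  have h := Φ.map_smul_le (a := (x / y).toNNReal) (by
    rw [← ENNReal.coe_le_coe, ENNReal.coe_toNNReal hne]; simpa using hle) y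
  rw [ENNReal.coe_toNNReal hne, ENNReal.div_mul_cancel hy0 hy] at h
  calc Φ x ≤ x / y * Φ y := h
    _ ≤ 1 * Φ y := by gcongr
    _ = Φ y := one_mul _

theorem measurable (Φ : YoungFunction) : Measurable Φ := Φ.mono.measurable

end YoungFunction

variable {α : Type*} [MeasurableSpace α]

/-- The set of all `0 < k < ∞` with `∫ Φ(|f| / k) dμ ≤ 1`. -/
def luxemburgSet (Φ : YoungFunction) (μ : Measure α) (f : α → ℂ) : Set ℝ :=
  {k : ℝ | 0 < k ∧ ∫⁻ x, Φ (‖f x‖ₑ / ENNReal.ofReal k) ∂μ ≤ 1}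

/-- The Luxemburg norm `inf {k > 0 : ∫ Φ(|f| / k) dμ ≤ 1}` (meaningful if this set is not
empty). -/
def luxemburgNorm (Φ : YoungFunction) (μ : Measure α) (f : α → ℂ) : ℝ :=
  sInf (luxemburgSet Φ μ f)

section Luxemburg

variable {Φ : YoungFunction} {μ : Measure α} {f g : α → ℂ}

theorem luxemburgSet_congr (h : f =ᵐ[μ] g) : luxemburgSet Φ μ f = luxemburgSet Φ μ g := by
  ext k
  have : ∫⁻ x, Φ (‖f x‖ₑ / ENNReal.ofReal k) ∂μ = ∫⁻ x, Φ (‖g x‖ₑ / ENNReal.ofReal k) ∂μ :=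
    lintegral_congr_ae (by filter_upwards [h] with x hx; rw [hx])
  simp [luxemburgSet, this]

theorem luxemburgNorm_congr (h : f =ᵐ[μ] g) : luxemburgNorm Φ μ f = luxemburgNorm Φ μ g := by
  rw [luxemburgNorm, luxemburgSet_congr h, luxemburgNorm]

theorem luxemburgSet_bddBelow : BddBelow (luxemburgSet Φ μ f) := ⟨0, fun _ hk => hk.1.le⟩

theorem luxemburgNorm_nonneg : 0 ≤ luxemburgNorm Φ μ f := Real.sInf_nonneg fun _ hk => hk.1.le

theorem luxemburgNorm_le {k : ℝ} (hk : k ∈ luxemburgSet Φ μ f) : luxemburgNorm Φ μ f ≤ k :=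
  csInf_le luxemburgSet_bddBelow hk

theorem luxemburgSet_mono {k l : ℝ} (hk : k ∈ luxemburgSet Φ μ f) (hkl : k ≤ l) :
    l ∈ luxemburgSet Φ μ f := by
  refine ⟨hk.1.trans_le hkl, le_trans (lintegral_mono fun x => Φ.mono ?_) hk.2⟩
  gcongr

theorem mem_luxemburgSet_of_lt (hf : (luxemburgSet Φ μ f).Nonempty) {k : ℝ}
    (hk : luxemburgNorm Φ μ f < k) : k ∈ luxemburgSet Φ μ f := by
  obtain ⟨l, hl, hlk⟩ := exists_lt_of_csInf_lt hf hk
  exact luxemburgSet_mono hl hlk.le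

theorem mem_luxemburgSet_zero {k : ℝ} (hk : 0 < k) : k ∈ luxemburgSet Φ μ (0 : α → ℂ) := by
  refine ⟨hk, ?_⟩
  simp [Φ.apply_zero]

theorem mem_luxemburgSet_add {k l : ℝ} (hfm : AEMeasurable f μ)
    (hk : k ∈ luxemburgSet Φ μ f) (hl : l ∈ luxemburgSet Φ μ g) :
    k + l ∈ luxemburgSet Φ μ (f + g) := by
  obtain ⟨hk0, hk⟩ := hk
  obtain ⟨hl0, hl⟩ := hl
  refine ⟨add_pos hk0 hl0, ?_⟩
  set k' : ℝ≥0 := ⟨k, hk0.le⟩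
  set l' : ℝ≥0 := ⟨l, hl0.le⟩
  have hk' : 0 < k' := hk0
  have hl' : 0 < l' := hl0
  have ek : ENNReal.ofReal k = k' := ENNReal.ofReal_eq_coe_nnreal hk0.le
  have el : ENNReal.ofReal l = l' := ENNReal.ofReal_eq_coe_nnreal hl0.le
  rw [ENNReal.ofReal_add hk0.le hl0.le]
  rw [ek] at hk ⊢
  rw [el] at hl ⊢
  set a : ℝ≥0 := k' / (k' + l')
  set b : ℝ≥0 := l' / (k' + l')
  have hs : k' + l' ≠ 0 := (add_pos hk' hl').ne'
  have hab : a + b = 1 := by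
    simp only [a, b]; rw [← add_div, div_self hs]
  have ha : ∀ x : ℝ≥0, (x : ℝ≥0∞) / (k' + l') = a * (x / k') := by
    intro x
    rw [← ENNReal.coe_add, ← ENNReal.coe_div hs, ← ENNReal.coe_div hk'.ne', ← ENNReal.coe_mul]
    congr 1
    simp only [a]
    field_simp
  have hb : ∀ x : ℝ≥0, (x : ℝ≥0∞) / (k' + l') = b * (x / l') := by
    intro x
    rw [← ENNReal.coe_add, ← ENNReal.coe_div hs, ← ENNReal.coe_div hl'.ne', ← ENNReal.coe_mul]
    congr 1
    simp only [b]
    field_simp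
  have hpt : ∀ x, Φ (‖(f + g) x‖ₑ / (k' + l')) ≤
      a * Φ (‖f x‖ₑ / k') + b * Φ (‖g x‖ₑ / l') := by
    intro x
    refine le_trans (Φ.mono ?_) (Φ.convex_le hab _ _)
    calc ‖(f + g) x‖ₑ / (k' + l') ≤ (‖f x‖ₑ + ‖g x‖ₑ) / (k' + l') := by
          gcongr; exact enorm_add_le _ _
      _ = ‖f x‖ₑ / (k' + l') + ‖g x‖ₑ / (k' + l') := ENNReal.add_div
      _ = _ := by rw [enorm_eq_nnnorm, enorm_eq_nnnorm, ha, hb]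
  have hm : AEMeasurable (fun x => (a : ℝ≥0∞) * Φ (‖f x‖ₑ / k')) μ :=
    (Φ.measurable.comp_aemeasurable (hfm.enorm.div_const _)).const_mul _
  calc ∫⁻ x, Φ (‖(f + g) x‖ₑ / (k' + l')) ∂μ
      ≤ ∫⁻ x, (a * Φ (‖f x‖ₑ / k') + b * Φ (‖g x‖ₑ / l')) ∂μ := lintegral_mono hpt
    _ = a * ∫⁻ x, Φ (‖f x‖ₑ / k') ∂μ + b * ∫⁻ x, Φ (‖g x‖ₑ / l') ∂μ := by
        rw [lintegral_add_left' hm, lintegral_const_mul' _ _ ENNReal.coe_ne_top,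
          lintegral_const_mul' _ _ ENNReal.coe_ne_top]
    _ ≤ a * 1 + b * 1 := by gcongr
    _ = 1 := by rw [mul_one, mul_one, ← ENNReal.coe_add, hab, ENNReal.coe_one]

theorem mem_luxemburgSet_smul {k : ℝ} {c : ℂ} (hc : c ≠ 0) (hk : k ∈ luxemburgSet Φ μ f) :
    ‖c‖ * k ∈ luxemburgSet Φ μ (c • f) := by
  have hc' : 0 < ‖c‖ := norm_pos_iff.2 hc
  refine ⟨mul_pos hc' hk.1, le_of_eq_of_le (lintegral_congr fun x => ?_) hk.2⟩
  congr 1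
  rw [Pi.smul_apply, enorm_smul, ENNReal.ofReal_mul hc'.le, ofReal_norm,
    ENNReal.mul_div_mul_left _ _ (by simpa using hc) enorm_ne_top]

theorem ae_eq_zero_of_luxemburgNorm_eq_zero (hfm : Measurable f)
    (hf : (luxemburgSet Φ μ f).Nonempty) (h0 : luxemburgNorm Φ μ f = 0) : f =ᵐ[μ] 0 := by
  have hk : ∀ k : ℝ, 0 < k → ∫⁻ x, Φ (‖f x‖ₑ / ENNReal.ofReal k) ∂μ ≤ 1 := fun k hk =>
    (mem_luxemburgSet_of_lt hf (h0 ▸ hk)).2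
  let u : ℕ → α → ℝ≥0∞ := fun n x => Φ (‖f x‖ₑ / ENNReal.ofReal (1 / (n + 1)))
  have hum : ∀ n, Measurable (u n) := fun n =>
    Φ.measurable.comp (hfm.enorm.div_const _)
  have hfatou : ∫⁻ x, liminf (fun n => u n x) atTop ∂μ ≤ 1 :=
    (lintegral_liminf_le hum).trans
      ((liminf_le_liminf (Eventually.of_forall fun n => hk _ (by positivity))).trans (by simp))
  have hlt := ae_lt_top (Measurable.liminf hum)
    (ne_top_of_le_ne_top ENNReal.one_ne_top hfatou)
  filter_upwards [hlt] with x hx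
  by_contra hne
  have hne' : ‖f x‖ₑ ≠ 0 := by simpa using hne
  have ht : Tendsto (fun n : ℕ => ‖f x‖ₑ / ENNReal.ofReal (1 / ((n : ℝ) + 1))) atTop (𝓝 ∞) := by
    have h1 : Tendsto (fun n : ℕ => ENNReal.ofReal (1 / ((n : ℝ) + 1))) atTop (𝓝 0) := by
      simpa using ENNReal.tendsto_ofReal tendsto_one_div_add_atTop_nhds_zero_nat
    have h2 := ENNReal.Tendsto.const_div (a := ‖f x‖ₑ) h1 (Or.inr enorm_ne_top)
    rwa [ENNReal.div_zero hne'] at h2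
  have hlim : Tendsto (fun n => u n x) atTop (𝓝 ∞) := Φ.tendsto_top'.comp ht
  rw [hlim.liminf_eq] at hx
  exact lt_irrefl _ hx

theorem mem_luxemburgSet_of_tendsto {u : ℕ → α → ℂ} (hu : ∀ n, AEMeasurable (u n) μ)
    (hlim : ∀ᵐ x ∂μ, Tendsto (fun n => u n x) atTop (𝓝 (f x))) {k l : ℝ} (hk0 : 0 < k)
    (hkl : k < l) (hk : ∀ᶠ n in atTop, k ∈ luxemburgSet Φ μ (u n)) :
    l ∈ luxemburgSet Φ μ f := by
  have hl0 : 0 < l := hk0.trans hkl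
  refine ⟨hl0, ?_⟩
  have hpt : ∀ᵐ x ∂μ, Φ (‖f x‖ₑ / ENNReal.ofReal l) ≤
      liminf (fun n => Φ (‖u n x‖ₑ / ENNReal.ofReal k)) atTop := by
    filter_upwards [hlim] with x hx
    rcases eq_or_ne (f x) 0 with h0 | h0
    · simp [h0, Φ.apply_zero]
    have h0' : ‖f x‖ₑ ≠ 0 := by simpa using h0
    have hlt : ‖f x‖ₑ / ENNReal.ofReal l < ‖f x‖ₑ / ENNReal.ofReal k := by
      rw [div_eq_mul_inv, div_eq_mul_inv]
      refine (ENNReal.mul_lt_mul_iff_right h0' enorm_ne_top).2 ?_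
      exact ENNReal.inv_lt_inv.2 ((ENNReal.ofReal_lt_ofReal_iff hl0).2 hkl)
    have ht : Tendsto (fun n => ‖u n x‖ₑ / ENNReal.ofReal k) atTop
        (𝓝 (‖f x‖ₑ / ENNReal.ofReal k)) :=
      ENNReal.Tendsto.div_const hx.enorm (Or.inl h0')
    refine le_liminf_of_le (by isBoundedDefault) ?_
    filter_upwards [ht.eventually (lt_mem_nhds hlt)] with n hn
    exact Φ.mono hn.le
  calc ∫⁻ x, Φ (‖f x‖ₑ / ENNReal.ofReal l) ∂μ
      ≤ ∫⁻ x, liminf (fun n => Φ (‖u n x‖ₑ / ENNReal.ofReal k)) atTop ∂μ :=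
        lintegral_mono_ae hpt
    _ ≤ liminf (fun n => ∫⁻ x, Φ (‖u n x‖ₑ / ENNReal.ofReal k) ∂μ) atTop :=
        lintegral_liminf_le' fun n =>
          Φ.measurable.comp_aemeasurable ((hu n).enorm.div_const _)
    _ ≤ liminf (fun _ : ℕ => (1 : ℝ≥0∞)) atTop := liminf_le_liminf (hk.mono fun n hn => hn.2)
    _ = 1 := by simp

theorem YoungFunction.exists_two_pow_le (Φ : YoungFunction) :
    ∃ N : ℕ, ∀ n : ℕ, (2 : ℝ≥0∞) ^ n ≤ Φ (2 ^ (n + N)) := by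
  have ht : Tendsto (fun n : ℕ => (2 : ℝ≥0∞) ^ n) atTop (𝓝 ∞) :=
    ENNReal.tendsto_pow_atTop_nhds_top_iff.2 (by norm_num)
  obtain ⟨N, hN⟩ := ((Φ.tendsto_top'.comp ht).eventually
    (lt_mem_nhds (ENNReal.one_lt_top))).exists
  refine ⟨N, fun n => ?_⟩
  have h := Φ.map_smul_le (a := (2 ^ n)⁻¹) (inv_le_one_of_one_le₀ (one_le_pow₀ (by norm_num)))
    (2 ^ (n + N))
  have h2 : ((2 : ℝ≥0∞) ^ n) ≠ 0 := by positivity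
  have h2' : ((2 : ℝ≥0∞) ^ n) ≠ ∞ := by finiteness
  have e : (((2 ^ n)⁻¹ : ℝ≥0) : ℝ≥0∞) = ((2 : ℝ≥0∞) ^ n)⁻¹ := by
    rw [ENNReal.coe_inv (by positivity)]; simp
  rw [e, pow_add, ← mul_assoc, ENNReal.inv_mul_cancel h2 h2', one_mul, ← pow_add] at h
  calc (2 : ℝ≥0∞) ^ n = 2 ^ n * 1 := (mul_one _).symm
    _ ≤ 2 ^ n * ((2 ^ n)⁻¹ * Φ (2 ^ (n + N))) := by gcongr; exact hN.le.trans h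
    _ = Φ (2 ^ (n + N)) := by rw [← mul_assoc, ENNReal.mul_inv_cancel h2 h2', one_mul]

theorem ae_cauchySeq_of_mem_luxemburgSet {u : ℕ → α → ℂ} (hu : ∀ n, AEMeasurable (u n) μ)
    (h : ∀ n, (1 / 4 : ℝ) ^ n ∈ luxemburgSet Φ μ (u n - u (n + 1))) :
    ∀ᵐ x ∂μ, CauchySeq fun n => u n x := by
  obtain ⟨N, hN⟩ := Φ.exists_two_pow_le
  let v : ℕ → α → ℝ≥0∞ := fun n x =>
    Φ (‖(u n - u (n + 1)) x‖ₑ / ENNReal.ofReal ((1 / 4 : ℝ) ^ n))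
  have hv : ∀ n, AEMeasurable (v n) μ := fun n =>
    Φ.measurable.comp_aemeasurable (((hu n).sub (hu (n + 1))).enorm.div_const _)
  have hs : ∀ n, μ {x | (2 : ℝ≥0∞) ^ n ≤ v n x} ≤ (1 / 2 : ℝ≥0∞) ^ n := fun n => by
    refine (meas_ge_le_lintegral_div (hv n) (by positivity) (by finiteness)).trans ?_
    calc (∫⁻ x, v n x ∂μ) / 2 ^ n ≤ 1 / 2 ^ n := by gcongr; exact (h n).2
      _ = (1 / 2 : ℝ≥0∞) ^ n := by rw [one_div, one_div, ENNReal.inv_pow]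
  have hsum : ∑' n, μ {x | (2 : ℝ≥0∞) ^ n ≤ v n x} ≠ ∞ := by
    refine ne_top_of_le_ne_top ?_ (ENNReal.tsum_le_tsum hs)
    rw [ENNReal.tsum_geometric]
    simp
  filter_upwards [ae_eventually_notMem hsum] with x hx
  refine cauchySeq_of_summable_dist ?_
  refine Summable.of_norm_bounded_eventually_nat (g := fun n => (2 : ℝ) ^ N * (1 / 2) ^ n)
    ((summable_geometric_of_lt_one (by norm_num) (by norm_num)).mul_left _) ?_
  filter_upwards [hx] with n hn
  have h1 : Φ (‖(u n - u (n + 1)) x‖ₑ / ENNReal.ofReal ((1 / 4 : ℝ) ^ n)) <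
      Φ (2 ^ (n + N)) := (not_le.1 hn).trans_le (hN n)
  have h2 := (lt_of_not_ge fun h => h1.not_ge (Φ.mono h)).le
  have h3 : (0 : ℝ) < (1 / 4) ^ n := by positivity
  rw [ENNReal.div_le_iff (by simp) (by finiteness)] at h2
  have e : (2 : ℝ≥0∞) ^ (n + N) = ENNReal.ofReal (2 ^ (n + N)) := by
    rw [ENNReal.ofReal_pow (by norm_num)]; simp
  rw [e, ← ENNReal.ofReal_mul (by positivity), ← ofReal_norm,
    ENNReal.ofReal_le_ofReal_iff (by positivity)] at h2
  rw [Real.norm_of_nonneg dist_nonneg, dist_eq_norm]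
  refine h2.trans_eq ?_
  have h4 : (1 / 4 : ℝ) ^ n = (1 / 2) ^ n * (1 / 2) ^ n := by rw [← mul_pow]; norm_num
  have h5 : (2 : ℝ) ^ n * (1 / 2) ^ n = 1 := by rw [← mul_pow]; norm_num
  rw [h4, pow_add]
  linear_combination (2 : ℝ) ^ N * (1 / 2) ^ n * h5

end Luxemburg

/-- The Orlicz space `L^Φ(μ)`: the classes (modulo equality `μ`-almost everywhere) of complex
measurable functions `f` such that `∫ Φ(|f| / k) dμ ≤ 1` for some `0 < k < ∞`. -/
def OrliczSpace (Φ : YoungFunction) (μ : Measure α) : Submodule ℂ (α →ₘ[μ] ℂ) where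
  carrier := {f | (luxemburgSet Φ μ f).Nonempty}
  zero_mem' := by
    refine ⟨1, ?_⟩
    rw [luxemburgSet_congr AEEqFun.coeFn_zero]
    exact mem_luxemburgSet_zero one_pos
  add_mem' := by
    rintro f g ⟨k, hk⟩ ⟨l, hl⟩
    refine ⟨k + l, ?_⟩
    rw [luxemburgSet_congr (AEEqFun.coeFn_add f g)]
    exact mem_luxemburgSet_add f.aemeasurable hk hl
  smul_mem' := by
    rintro c f ⟨k, hk⟩
    rcases eq_or_ne c 0 with rfl | hc
    · refine ⟨1, ?_⟩
      rw [zero_smul, luxemburgSet_congr AEEqFun.coeFn_zero]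
      exact mem_luxemburgSet_zero one_pos
    · refine ⟨‖c‖ * k, ?_⟩
      rw [luxemburgSet_congr (AEEqFun.coeFn_smul c f)]
      exact mem_luxemburgSet_smul hc hk

namespace OrliczSpace

variable {Φ : YoungFunction} {μ : Measure α}

theorem luxemburgNorm_add_le (f g : OrliczSpace Φ μ) :
    luxemburgNorm Φ μ (f + g : OrliczSpace Φ μ).1 ≤
      luxemburgNorm Φ μ f.1 + luxemburgNorm Φ μ g.1 := by
  refine le_of_forall_pos_le_add fun ε hε => ?_
  have hf := mem_luxemburgSet_of_lt f.2 (lt_add_of_pos_right (luxemburgNorm Φ μ f.1) (half_pos hε))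
  have hg := mem_luxemburgSet_of_lt g.2 (lt_add_of_pos_right (luxemburgNorm Φ μ g.1) (half_pos hε))
  have h := luxemburgNorm_le (mem_luxemburgSet_add f.1.aemeasurable hf hg)
  have e : luxemburgNorm Φ μ (f + g : OrliczSpace Φ μ).1 =
      luxemburgNorm Φ μ ((f.1 : α → ℂ) + g.1) := luxemburgNorm_congr (AEEqFun.coeFn_add f.1 g.1)
  rw [e]
  linarith

theorem luxemburgNorm_smul_le (c : ℂ) (f : OrliczSpace Φ μ) :
    luxemburgNorm Φ μ (c • f : OrliczSpace Φ μ).1 ≤ ‖c‖ * luxemburgNorm Φ μ f.1 := by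
  have e : luxemburgNorm Φ μ (c • f : OrliczSpace Φ μ).1 =
      luxemburgNorm Φ μ (c • (f.1 : α → ℂ)) := luxemburgNorm_congr (AEEqFun.coeFn_smul c f.1)
  rw [e]
  rcases eq_or_ne c 0 with rfl | hc
  · rw [zero_smul, norm_zero, zero_mul]
    exact le_of_forall_pos_le_add fun ε hε => by
      simpa using luxemburgNorm_le (mem_luxemburgSet_zero (Φ := Φ) (μ := μ) hε)
  · have hc' : 0 < ‖c‖ := norm_pos_iff.2 hc
    refine le_of_forall_pos_le_add fun ε hε => ?_
    have hf := mem_luxemburgSet_of_lt f.2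
      (lt_add_of_pos_right (luxemburgNorm Φ μ f.1) (div_pos hε hc'))
    have h := luxemburgNorm_le (mem_luxemburgSet_smul hc hf)
    rwa [mul_add, mul_div_cancel₀ _ hc'.ne'] at h

/-- The Orlicz space is normed by the Luxemburg norm. -/
instance : NormedAddCommGroup (OrliczSpace Φ μ) :=
  AddGroupNorm.toNormedAddCommGroup
    { toFun := fun f => luxemburgNorm Φ μ f.1
      map_zero' := by
        have h := luxemburgNorm_smul_le (0 : ℂ) (0 : OrliczSpace Φ μ)
        rw [norm_zero, zero_mul, zero_smul] at h
        exact le_antisymm h luxemburgNorm_nonneg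
      add_le' := luxemburgNorm_add_le
      neg' := by
        have key : ∀ f : OrliczSpace Φ μ,
            luxemburgNorm Φ μ (-f).1 ≤ luxemburgNorm Φ μ f.1 := fun f => by
          have h := luxemburgNorm_smul_le (-1 : ℂ) f
          rwa [norm_neg, norm_one, one_mul, show (-1 : ℂ) • f = -f from neg_one_smul ℂ f] at h
        intro f
        exact le_antisymm (key f) ((congrArg (fun h : OrliczSpace Φ μ => luxemburgNorm Φ μ h.1)
          (neg_neg f)).symm.trans_le (key (-f)))
      eq_zero_of_map_eq_zero' := by
        intro f hf
        exact Subtype.ext (AEEqFun.ext ((ae_eq_zero_of_luxemburgNorm_eq_zero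
          f.1.measurable f.2 hf).trans AEEqFun.coeFn_zero.symm)) }

theorem norm_def (f : OrliczSpace Φ μ) : ‖f‖ = luxemburgNorm Φ μ f.1 := rfl

instance : NormedSpace ℂ (OrliczSpace Φ μ) where
  norm_smul_le := luxemburgNorm_smul_le

/-- The Orlicz space is a Banach space. -/
instance : CompleteSpace (OrliczSpace Φ μ) := by
  refine Metric.complete_of_convergent_controlled_sequences (fun n => (1 / 4 : ℝ) ^ n)
    (fun n => by positivity) fun u hu => ?_
  have hmem : ∀ N n m : ℕ, N ≤ n → N ≤ m →
      (1 / 4 : ℝ) ^ N ∈ luxemburgSet Φ μ ((u n).1 - (u m).1 : α → ℂ) := fun N n m hn hm => by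
    have h := mem_luxemburgSet_of_lt (u n - u m).2 ((dist_eq_norm (u n) (u m)) ▸ hu N n m hn hm)
    have e : ((u n - u m : OrliczSpace Φ μ).1 : α → ℂ) =ᵐ[μ] (u n).1 - (u m).1 :=
      AEEqFun.coeFn_sub (u n).1 (u m).1
    rwa [luxemburgSet_congr e] at h
  have hmeas : ∀ n, AEMeasurable ((u n).1 : α → ℂ) μ := fun n => (u n).1.aemeasurable
  have hc := ae_cauchySeq_of_mem_luxemburgSet hmeas fun n => hmem n n (n + 1) le_rfl n.le_succ
  have hlim : ∀ᵐ x ∂μ, Tendsto (fun n => ((u n).1 : α → ℂ) x) atTop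
      (𝓝 (limUnder atTop fun n => ((u n).1 : α → ℂ) x)) :=
    hc.mono fun x hx => hx.tendsto_limUnder
  let g : α → ℂ := fun x => limUnder atTop fun n => ((u n).1 : α → ℂ) x
  have hg : AEStronglyMeasurable g μ :=
    aestronglyMeasurable_of_tendsto_ae atTop (fun n => (u n).1.aestronglyMeasurable) hlim
  have hgap : ∀ N : ℕ, 2 * (1 / 4 : ℝ) ^ N ∈ luxemburgSet Φ μ (g - (u N).1) := fun N => by
    have h0 : (0 : ℝ) < (1 / 4) ^ N := by positivity
    refine mem_luxemburgSet_of_tendsto (u := fun n => ((u n).1 - (u N).1 : α → ℂ))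
      (fun n => (hmeas n).sub (hmeas N)) ?_ h0 (by linarith)
      ((eventually_ge_atTop N).mono fun n hn => hmem N n N hn le_rfl)
    filter_upwards [hlim] with x hx
    exact hx.sub_const _
  obtain ⟨k, hk⟩ := (u 0).2
  have hgmem : AEEqFun.mk g hg ∈ OrliczSpace Φ μ := by
    refine ⟨2 * (1 / 4 : ℝ) ^ 0 + k, ?_⟩
    rw [luxemburgSet_congr (AEEqFun.coeFn_mk g hg)]
    have h := mem_luxemburgSet_add (hg.aemeasurable.sub (hmeas 0)) (hgap 0) hk
    rwa [sub_add_cancel] at h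
  refine ⟨⟨AEEqFun.mk g hg, hgmem⟩, ?_⟩
  have hz : Tendsto (fun n : ℕ => 2 * (1 / 4 : ℝ) ^ n) atTop (𝓝 0) := by
    simpa using (tendsto_pow_atTop_nhds_zero_of_lt_one (r := (1 / 4 : ℝ))
      (by norm_num) (by norm_num)).const_mul 2
  refine tendsto_iff_dist_tendsto_zero.2 (squeeze_zero (fun _ => dist_nonneg) (fun n => ?_) hz)
  rw [dist_comm, dist_eq_norm, norm_def]
  refine luxemburgNorm_le ?_
  have e : (((⟨AEEqFun.mk g hg, hgmem⟩ - u n : OrliczSpace Φ μ).1 : α →ₘ[μ] ℂ) : α → ℂ)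
      =ᵐ[μ] g - (u n).1 := by
    refine (AEEqFun.coeFn_sub (AEEqFun.mk g hg) (u n).1).trans ?_
    filter_upwards [AEEqFun.coeFn_mk g hg] with x hx
    simp [hx]
  rw [luxemburgSet_congr e]
  exact hgap n

end OrliczSpace

/-- The convolution `(μ * f)(t) = ∫ f(s⁻¹ t) dμ(s)` of a complex measure and a function on a
group. -/
def convMeasure {G : Type*} [Group G] [MeasurableSpace G] (μ : ComplexMeasure G) (f : G → ℂ)
    (t : G) : ℂ :=
  VectorMeasure.integral μ (fun s => f (s⁻¹ * t)) (ContinuousLinearMap.mul ℝ ℂ)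

end

/-!
The operator `φ ↦ μ * φ` is represented by a Bochner-integrable kernel `F`, and formally `F s` is
the right translate of `μ` by `s`. The proof makes sense of this at a single well-chosen point `s₀`.

Test against continuous functions: let `⟨f, g⟩ = ∫ g f dm` for `f ∈ L^Φ(G)` and `g ∈ C(G, ℝ)`, which
is continuous in `f` because `L^Φ(G)` embeds into `L¹(G)`
(`YoungFunction.exists_lintegral_enorm_le`). Passing from indicator functions to continuous `φ`
(`integral_smul_pairing_eq`) and using the adjoint of convolution (`integral_smul_convMeasure`),
`∫ φ(s) ⟨F s, g⟩ ds = ∫ φ(s) (∫ g(us) dμ(u)) ds` for all continuous `φ`, so that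
`⟨F s, g⟩ = ∫ g(us) dμ(u)` for almost every `s` (`pairing_ae_eq_integralCLM`).

The exceptional null set depends on `g`, and `C(G, ℝ)` need not be separable. Instead of discarding
null sets, one takes a limit. Since `F` is almost separably valued and `G` is compact, there are a
point `s₀` and a vector `h` such that the filter of all neighbourhoods of `s₀`, of all conull sets
and of all preimages under `F` of neighbourhoods of `h` is proper
(`exists_neBot_nhds_inf_ae_inf_comap`). As `s ↦ ∫ g(us) dμ(u)` is continuous, the limit along this
filter gives `⟨h, g⟩ = ∫ g(us₀) dμ(u)` for every `g` simultaneously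
(`exists_forall_pairing_eq_integralCLM`).

Finally `m` is right invariant, so `f(t) = h(ts₀)` belongs to `L^Φ(G)` and satisfies
`∫ g f dm = ∫ g dμ` for all continuous `g`. Regularity of `|μ|` and `m` provides, for every Borel
set `A`, bounded continuous functions that converge to `χ_A` almost everywhere for both measures,
and dominated convergence yields `μ(A) = ∫_A f dm`.
-/

/-! ### Approximation by continuous functions -/

section Approximation

variable {X : Type*} [TopologicalSpace X] [MeasurableSpace X] [BorelSpace X]

/-- For a finite regular measure, an indicator function is the almost everywhere limit of
continuous functions bounded by `1`. -/
theorem exists_continuousMap_tendsto_indicator [CompactSpace X] [T2Space X] (ρ : Measure X)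
    [IsFiniteMeasure ρ] [ρ.Regular] {A : Set X} (hA : MeasurableSet A) :
    ∃ g : ℕ → C(X, ℝ), (∀ n x, |g n x| ≤ 1) ∧
      ∀ᵐ x ∂ρ, Tendsto (fun n => g n x) atTop (𝓝 (A.indicator 1 x)) := by
  have hmem : MemLp (A.indicator (1 : X → ℝ)) 1 ρ :=
    memLp_one_iff_integrable.2 ((integrable_const (1 : ℝ)).indicator hA)
  choose g hg hgm using fun n : ℕ => hmem.exists_boundedContinuous_eLpNorm_sub_le
    ENNReal.one_ne_top (ε := ((n : ℝ≥0∞) + 1)⁻¹) (by simp)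
  have hlim : Tendsto (fun n => eLpNorm (⇑(g n) - A.indicator (1 : X → ℝ)) 1 ρ) atTop (𝓝 0) := by
    refine tendsto_of_tendsto_of_tendsto_of_le_of_le tendsto_const_nhds
      (h := fun n : ℕ => ((n : ℝ≥0∞) + 1)⁻¹) ?_ (fun _ => zero_le) fun n => ?_
    · have := (tendsto_add_atTop_iff_nat 1).2 ENNReal.tendsto_inv_nat_nhds_zero
      simpa using this
    · simpa only [eLpNorm_sub_comm] using hg n
  obtain ⟨ns, -, hns⟩ := (tendstoInMeasure_of_tendsto_eLpNorm one_ne_zero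
    (fun n => (hgm n).1) hmem.1 hlim).exists_seq_tendsto_ae
  -- Truncation to `[0, 1]` gives the uniform bound and does not affect the limit.
  refine ⟨fun n => ⟨fun x => max 0 (min 1 (g (ns n) x)), by fun_prop⟩, fun n x => ?_, ?_⟩
  · rw [abs_le]
    constructor
    · exact le_trans (by norm_num) (le_max_left _ _)
    · exact max_le zero_le_one (min_le_left _ _)
  · filter_upwards [hns] with x hx
    have hc : Continuous fun y : ℝ => max 0 (min 1 y) := by fun_prop
    have := (hc.tendsto _).comp hx
    have e : max 0 (min 1 (A.indicator (1 : X → ℝ) x)) = A.indicator 1 x := by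
      by_cases h : x ∈ A <;> simp [h]
    rw [e] at this
    exact this

theorem tendsto_integral_smul_of_abs_le_one {ρ : Measure X} {a : X → ℂ}
    (ha : Integrable a ρ) {A : Set X} (hA : MeasurableSet A) {g : ℕ → C(X, ℝ)}
    (hg : ∀ n x, |g n x| ≤ 1)
    (hlim : ∀ᵐ x ∂ρ, Tendsto (fun n => g n x) atTop (𝓝 (A.indicator 1 x))) :
    Tendsto (fun n => ∫ x, g n x • a x ∂ρ) atTop (𝓝 (∫ x in A, a x ∂ρ)) := by
  rw [← integral_indicator hA]
  refine tendsto_integral_of_dominated_convergence (fun x => ‖a x‖)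
    (fun n => (g n).continuous.measurable.aestronglyMeasurable.smul ha.1) ha.norm
    (fun n => Eventually.of_forall fun x => ?_) ?_
  · rw [norm_smul]
    exact mul_le_of_le_one_left (norm_nonneg _) (hg n x)
  · filter_upwards [hlim] with x hx
    have e : A.indicator a x = A.indicator (1 : X → ℝ) x • a x := by
      by_cases h : x ∈ A <;> simp [h]
    rw [e]
    exact hx.smul_const _

theorem ae_eq_zero_of_forall_integral_continuousMap_smul_eq_zero [CompactSpace X] [T2Space X]
    {ρ : Measure X} [IsFiniteMeasure ρ] [ρ.Regular] {a : X → ℂ} (ha : Integrable a ρ)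
    (h : ∀ φ : C(X, ℝ), ∫ x, φ x • a x ∂ρ = 0) : a =ᵐ[ρ] 0 := by
  refine ha.ae_eq_zero_of_forall_setIntegral_eq_zero fun A hA _ => ?_
  obtain ⟨g, hg, hlim⟩ := exists_continuousMap_tendsto_indicator ρ hA
  have := tendsto_integral_smul_of_abs_le_one ha hA hg hlim
  simp only [h] at this
  exact tendsto_nhds_unique this tendsto_const_nhds

end Approximation

/-! ### Essential values of strongly measurable functions -/

/-- A strongly measurable function `F` on a compact space with a nonzero measure has an essential
value `h` at some point `s`: every neighbourhood of `s` contains a set of positive measure on which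
`F` is as close to `h` as desired. -/
theorem exists_neBot_nhds_inf_ae_inf_comap {X E : Type*} [TopologicalSpace X] [CompactSpace X]
    [MeasurableSpace X] [PseudoMetricSpace E] {m : Measure X} [NeZero m] {F : X → E}
    (hF : AEStronglyMeasurable F m) :
    ∃ (s : X) (h : E), (𝓝 s ⊓ (ae m ⊓ comap F (𝓝 h))).NeBot := by
  obtain ⟨F', hF', hFF'⟩ := hF
  have hsep := hF'.isSeparable_range
  have := hsep.secondCountableTopology
  have hL : IsLindelof (Set.range F') := isLindelof_iff_lindelofSpace.2 inferInstance
  have hle : map F (ae m) ≤ 𝓟 (Set.range F') := by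
    rw [le_principal_iff, mem_map]
    filter_upwards [hFF'] with x hx
    exact ⟨x, hx.symm⟩
  obtain ⟨h, -, hh⟩ := hL hle
  have hne : (ae m ⊓ comap F (𝓝 h)).NeBot := by
    have h1 : (map F (ae m) ⊓ 𝓝 h).NeBot := by rw [inf_comm]; exact hh
    rw [← Filter.push_pull] at h1
    exact h1.of_map
  obtain ⟨s, hs⟩ := exists_clusterPt_of_compactSpace (ae m ⊓ comap F (𝓝 h))
  exact ⟨s, h, hs⟩

/-! ### Orlicz spaces over finite measures -/

section Orlicz

variable {α : Type*} [MeasurableSpace α]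

/-- Over a finite measure the `L¹`-norm is dominated by the Luxemburg norm: since
`Φ (2 ^ N) ≥ 1` for some `N`, convexity gives `x ≤ 2 ^ N * (1 + Φ x)`. -/
theorem YoungFunction.exists_lintegral_enorm_le (Φ : YoungFunction) (μ : Measure α)
    [IsFiniteMeasure μ] :
    ∃ C : ℝ≥0, ∀ (f : α → ℂ) (k : ℝ), k ∈ luxemburgSet Φ μ f →
      ∫⁻ x, ‖f x‖ₑ ∂μ ≤ C * ENNReal.ofReal k := by
  obtain ⟨N, hN⟩ := Φ.exists_two_pow_le
  have h1 : 1 ≤ Φ (2 ^ N) := by simpa using hN 0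
  have hlin : ∀ x : ℝ≥0, (x : ℝ≥0∞) ≤ 2 ^ N * (1 + Φ x) := by
    intro x
    rcases le_total x (2 ^ N) with hx | hx
    · calc (x : ℝ≥0∞) ≤ 2 ^ N * 1 := by rw [mul_one]; exact_mod_cast hx
        _ ≤ 2 ^ N * (1 + Φ x) := by gcongr; exact le_self_add
    · have hx0 : x ≠ 0 := (lt_of_lt_of_le (by positivity) hx).ne'
      have h := Φ.map_smul_le (a := 2 ^ N / x) (div_le_one_of_le₀ hx zero_le) x
      have e : (((2 ^ N / x : ℝ≥0)) : ℝ≥0∞) * x = 2 ^ N := by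
        rw [← ENNReal.coe_mul, div_mul_cancel₀ _ hx0]; simp
      rw [e] at h
      calc (x : ℝ≥0∞) = x * 1 := (mul_one _).symm
        _ ≤ x * (((2 ^ N / x : ℝ≥0)) * Φ x) := by gcongr; exact h1.trans h
        _ = 2 ^ N * Φ x := by rw [← mul_assoc, mul_comm (x : ℝ≥0∞), e]
        _ ≤ 2 ^ N * (1 + Φ x) := by gcongr; exact le_add_self
  have hfin : (2 : ℝ≥0∞) ^ N * (μ Set.univ + 1) ≠ ∞ :=
    ENNReal.mul_ne_top (by finiteness) (by finiteness)
  refine ⟨(2 ^ N * (μ Set.univ + 1)).toNNReal, fun f k hk => ?_⟩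
  rw [ENNReal.coe_toNNReal hfin]
  have hk0 : ENNReal.ofReal k ≠ 0 := by simpa using hk.1
  calc ∫⁻ x, ‖f x‖ₑ ∂μ
      ≤ ∫⁻ x, (2 ^ N * ENNReal.ofReal k) * (1 + Φ (‖f x‖ₑ / ENNReal.ofReal k)) ∂μ := by
        refine lintegral_mono fun x => ?_
        have h := hlin (‖f x‖ₑ / ENNReal.ofReal k).toNNReal
        rw [ENNReal.coe_toNNReal (ENNReal.div_ne_top enorm_ne_top hk0),
          ENNReal.div_le_iff hk0 ENNReal.ofReal_ne_top] at h
        refine h.trans_eq ?_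
        ring
    _ = (2 ^ N * ENNReal.ofReal k) * (μ Set.univ +
          ∫⁻ x, Φ (‖f x‖ₑ / ENNReal.ofReal k) ∂μ) := by
        rw [lintegral_const_mul' _ _ (ENNReal.mul_ne_top (by finiteness) ENNReal.ofReal_ne_top),
          lintegral_add_left measurable_const, lintegral_one]
    _ ≤ (2 ^ N * ENNReal.ofReal k) * (μ Set.univ + 1) := by gcongr; exact hk.2
    _ = 2 ^ N * (μ Set.univ + 1) * ENNReal.ofReal k := by ring

namespace OrliczSpace

variable {Φ : YoungFunction} {μ : Measure α}

theorem integrable [IsFiniteMeasure μ] (f : OrliczSpace Φ μ) : Integrable (⇑f.1) μ := by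
  obtain ⟨C, hC⟩ := Φ.exists_lintegral_enorm_le μ
  obtain ⟨k, hk⟩ := f.2
  exact ⟨f.1.aestronglyMeasurable, (hC _ k hk).trans_lt
    (ENNReal.mul_lt_top ENNReal.coe_lt_top ENNReal.ofReal_lt_top)⟩

theorem exists_integral_norm_le (Φ : YoungFunction) (μ : Measure α) [IsFiniteMeasure μ] :
    ∃ C : ℝ≥0, ∀ f : OrliczSpace Φ μ, ∫ x, ‖f.1 x‖ ∂μ ≤ C * ‖f‖ := by
  obtain ⟨C, hC⟩ := Φ.exists_lintegral_enorm_le μ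
  refine ⟨C, fun f => ?_⟩
  have key : ∀ k : ℝ, ‖f‖ < k → ∫ x, ‖f.1 x‖ ∂μ ≤ C * k := fun k hk => by
    have hk' := mem_luxemburgSet_of_lt f.2 hk
    rw [integral_norm_eq_lintegral_enorm f.1.aestronglyMeasurable]
    refine (ENNReal.toReal_mono (ENNReal.mul_ne_top ENNReal.coe_ne_top ENNReal.ofReal_ne_top)
      (hC _ k hk')).trans_eq ?_
    rw [ENNReal.toReal_mul, ENNReal.toReal_ofReal hk'.1.le, ENNReal.coe_toReal]
  have hcont : Tendsto (fun k : ℝ => (C : ℝ) * k) (𝓝[>] ‖f‖) (𝓝 (C * ‖f‖)) :=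
    ((continuous_const.mul continuous_id).tendsto _).mono_left nhdsWithin_le_nhds
  exact ge_of_tendsto hcont (eventually_mem_nhdsWithin.mono fun k hk => key k hk)

/-- The continuous linear functional `f ↦ ∫ g f dμ` on `L^Φ(μ)`, for a continuous function `g` on a
compact space and a finite measure `μ`. -/
noncomputable def pairing {X : Type*} [TopologicalSpace X] [CompactSpace X] [MeasurableSpace X]
    [OpensMeasurableSpace X] (Φ : YoungFunction) (μ : Measure X) [IsFiniteMeasure μ]
    (g : C(X, ℝ)) : OrliczSpace Φ μ →L[ℂ] ℂ :=
  have hint (f : OrliczSpace Φ μ) : Integrable (fun x => g x • f.1 x) μ :=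
    (integrable f).bdd_smul ‖g‖ g.continuous.measurable.aestronglyMeasurable
      (Eventually.of_forall g.norm_coe_le_norm)
  LinearMap.mkContinuousOfExistsBound
    { toFun := fun f => ∫ x, g x • f.1 x ∂μ
      map_add' := fun f f' => by
        rw [← integral_add (hint f) (hint f')]
        refine integral_congr_ae ?_
        filter_upwards [AEEqFun.coeFn_add f.1 f'.1] with x hx
        rw [show (f + f').1 = f.1 + f'.1 from rfl, hx, Pi.add_apply, smul_add]
      map_smul' := fun c f => by
        rw [RingHom.id_apply, ← integral_smul]
        refine integral_congr_ae ?_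
        filter_upwards [AEEqFun.coeFn_smul c f.1] with x hx
        rw [show (c • f).1 = c • f.1 from rfl, hx, Pi.smul_apply, smul_comm] } <| by
    obtain ⟨C, hC⟩ := exists_integral_norm_le Φ μ
    refine ⟨‖g‖ * C, fun f => ?_⟩
    calc ‖∫ x, g x • f.1 x ∂μ‖ ≤ ∫ x, ‖g‖ * ‖f.1 x‖ ∂μ := by
          refine norm_integral_le_of_norm_le ((integrable f).norm.const_mul _)
            (Eventually.of_forall fun x => ?_)
          rw [norm_smul]
          gcongr
          exact g.norm_coe_le_norm x
      _ = ‖g‖ * ∫ x, ‖f.1 x‖ ∂μ := integral_const_mul _ _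
      _ ≤ ‖g‖ * (C * ‖f‖) := by gcongr; exact hC f
      _ = ‖g‖ * C * ‖f‖ := by ring

theorem pairing_apply {X : Type*} [TopologicalSpace X] [CompactSpace X] [MeasurableSpace X]
    [OpensMeasurableSpace X] (Φ : YoungFunction) (μ : Measure X) [IsFiniteMeasure μ]
    (g : C(X, ℝ)) (f : OrliczSpace Φ μ) : pairing Φ μ g f = ∫ x, g x • f.1 x ∂μ := rfl

/-- `L^Φ(μ)` is stable under composition with measure preserving maps. -/
theorem exists_coeFn_ae_eq_comp {T : α → α} (hT : MeasurePreserving T μ μ)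
    (f : OrliczSpace Φ μ) : ∃ f' : OrliczSpace Φ μ, ⇑f'.1 =ᵐ[μ] f.1 ∘ T := by
  have hae := AEEqFun.coeFn_compMeasurePreserving f.1 hT
  refine ⟨⟨f.1.compMeasurePreserving T hT, ?_⟩, hae⟩
  obtain ⟨k, hk0, hk⟩ := f.2
  refine ⟨k, ?_⟩
  rw [luxemburgSet_congr hae]
  refine ⟨hk0, le_of_eq_of_le ?_ hk⟩
  exact hT.lintegral_comp (f := fun x => Φ (‖f.1 x‖ₑ / ENNReal.ofReal k))
    (Φ.measurable.comp (f.1.measurable.enorm.div_const _))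

end OrliczSpace

end Orlicz

/-! ### Integration against a complex measure -/

/-- Integration of real continuous functions against a complex measure of finite variation on a
compact space, as a continuous real-linear functional. -/
noncomputable def MeasureTheory.ComplexMeasure.integralCLM {X : Type*} [TopologicalSpace X]
    [CompactSpace X] [MeasurableSpace X] [OpensMeasurableSpace X] (μ : ComplexMeasure X)
    [IsFiniteMeasure μ.variation] : C(X, ℝ) →L[ℝ] ℂ :=
  have hint (g : C(X, ℝ)) : μ.Integrable fun x => (g x : ℂ) :=
    Integrable.of_bound
      (Complex.measurable_ofReal.comp g.continuous.measurable).aestronglyMeasurable ‖g‖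
      (Eventually.of_forall fun x => by simpa using g.norm_coe_le_norm x)
  LinearMap.mkContinuousOfExistsBound
    { toFun := fun g => μ.integral (fun x => (g x : ℂ)) (ContinuousLinearMap.mul ℝ ℂ)
      map_add' := fun g g' => by
        rw [← VectorMeasure.integral_fun_add (hint g) (hint g')]
        simp
      map_smul' := fun c g => by
        rw [RingHom.id_apply, ← VectorMeasure.integral_fun_smul]
        simp } <| by
    refine ⟨‖ContinuousLinearMap.mul ℝ ℂ‖ * μ.variation.real Set.univ, fun g => ?_⟩
    refine VectorMeasure.norm_integral_le_integral_norm.trans ?_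
    rw [mul_assoc]
    gcongr
    calc ∫ x, ‖(g x : ℂ)‖ ∂μ.variation ≤ ∫ _, ‖g‖ ∂μ.variation :=
          integral_mono (hint g).norm (integrable_const _) fun x => by
            simpa using g.norm_coe_le_norm x
      _ = μ.variation.real Set.univ * ‖g‖ := by rw [integral_const, smul_eq_mul]

theorem MeasureTheory.ComplexMeasure.integralCLM_apply {X : Type*} [TopologicalSpace X]
    [CompactSpace X] [MeasurableSpace X] [OpensMeasurableSpace X] (μ : ComplexMeasure X)
    [IsFiniteMeasure μ.variation] (g : C(X, ℝ)) :
    μ.integralCLM g = μ.integral (fun x => (g x : ℂ)) (ContinuousLinearMap.mul ℝ ℂ) := rfl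

/-- Dominated convergence: continuous functions converging boundedly and `|μ|`-almost everywhere
to `χ_A` have integrals converging to `μ(A)`. -/
theorem tendsto_integralCLM_of_abs_le_one {X : Type*} [TopologicalSpace X] [CompactSpace X]
    [MeasurableSpace X] [OpensMeasurableSpace X] (μ : ComplexMeasure X)
    [IsFiniteMeasure μ.variation] {A : Set X} (hA : MeasurableSet A) {g : ℕ → C(X, ℝ)}
    (hg : ∀ n x, |g n x| ≤ 1)
    (hlim : ∀ᵐ x ∂μ.variation, Tendsto (fun n => g n x) atTop (𝓝 (A.indicator 1 x))) :
    Tendsto (fun n => μ.integralCLM (g n)) atTop (𝓝 (μ A)) := by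
  have e : μ.integral (A.indicator fun _ => (1 : ℂ)) (ContinuousLinearMap.mul ℝ ℂ) = μ A := by
    rw [VectorMeasure.integral_indicator_const _ hA]
    simp
  rw [← e]
  refine VectorMeasure.tendsto_integral_of_dominated_convergence (fun _ => 1)
    (fun n => (Complex.measurable_ofReal.comp (g n).continuous.measurable).aestronglyMeasurable)
    (integrable_const _) (fun n => Eventually.of_forall fun x => ?_) ?_
  · simpa using hg n x
  · filter_upwards [hlim] with x hx
    have := (Complex.continuous_ofReal.tendsto _).comp hx
    have e : ((A.indicator (1 : X → ℝ) x : ℝ) : ℂ) = A.indicator (fun _ => 1) x := by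
      by_cases h : x ∈ A <;> simp [h]
    rwa [e] at this

/-! ### Convolution with a complex measure -/

section Convolution

variable {G : Type*} [Group G] [TopologicalSpace G] [IsTopologicalGroup G]
  [MeasurableSpace G] [BorelSpace G] (μ : ComplexMeasure G) [IsFiniteMeasure μ.variation]

theorem integrable_convMeasure_integrand {φ : G → ℝ} (hφ : Measurable φ) {C : ℝ}
    (hC : ∀ x, |φ x| ≤ C) (t : G) : μ.Integrable fun u => (φ (u⁻¹ * t) : ℂ) :=
  Integrable.of_bound (Complex.measurable_ofReal.comp
      (hφ.comp (measurable_inv.mul_const t))).aestronglyMeasurable C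
    (Eventually.of_forall fun u => by simpa using hC (u⁻¹ * t))

theorem norm_convMeasure_le {φ : G → ℝ} (hφ : Measurable φ) {C : ℝ} (hC : ∀ x, |φ x| ≤ C)
    (t : G) : ‖convMeasure μ (fun x => (φ x : ℂ)) t‖ ≤
      ‖ContinuousLinearMap.mul ℝ ℂ‖ * (μ.variation.real Set.univ * C) := by
  refine VectorMeasure.norm_integral_le_integral_norm.trans ?_
  gcongr
  calc ∫ u, ‖(φ (u⁻¹ * t) : ℂ)‖ ∂μ.variation ≤ ∫ _, C ∂μ.variation :=
        integral_mono (integrable_convMeasure_integrand μ hφ hC t).norm (integrable_const _)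
          fun u => by simpa using hC (u⁻¹ * t)
    _ = μ.variation.real Set.univ * C := by rw [integral_const, smul_eq_mul]

theorem tendsto_convMeasure {φ : ℕ → G → ℝ} {ψ : G → ℝ} (hφ : ∀ n, Measurable (φ n)) {C : ℝ}
    (hC : ∀ n x, |φ n x| ≤ C) (hlim : ∀ x, Tendsto (fun n => φ n x) atTop (𝓝 (ψ x))) (t : G) :
    Tendsto (fun n => convMeasure μ (fun x => (φ n x : ℂ)) t) atTop
      (𝓝 (convMeasure μ (fun x => (ψ x : ℂ)) t)) :=
  VectorMeasure.tendsto_integral_of_dominated_convergence (fun _ => C)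
    (fun n => (integrable_convMeasure_integrand μ (hφ n) (hC n) t).1) (integrable_const _)
    (fun n => Eventually.of_forall fun u => by simpa using hC n (u⁻¹ * t))
    (Eventually.of_forall fun u => (Complex.continuous_ofReal.tendsto _).comp (hlim (u⁻¹ * t)))

/-- Adjointness of convolution with `μ`: for continuous `φ` and `g`,
`∫ g(t) (μ * φ)(t) dt = ∫ φ(s) (∫ g(us) dμ(u)) ds`. Both sides are the image under integration
against `μ` of one Bochner integral in `C(G)`, so that no measurability on `G × G` is involved. -/
theorem integral_smul_convMeasure [CompactSpace G] (m : Measure G) [IsFiniteMeasure m]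
    [m.IsMulLeftInvariant] (g φ : C(G, ℝ)) :
    ∫ t, g t • convMeasure μ (fun x => (φ x : ℂ)) t ∂m =
      ∫ s, φ s • μ.integralCLM (g.comp (ContinuousMap.mulRight s)) ∂m := by
  let K : C(G, C(G, ℝ)) := ContinuousMap.curry ⟨fun p : G × G => φ (p.2⁻¹ * p.1), by fun_prop⟩
  let K' : C(G, C(G, ℝ)) := ContinuousMap.curry ⟨fun p : G × G => g (p.2 * p.1), by fun_prop⟩
  have hK : Integrable (fun t => g t • K t) m :=
    (g.continuous.smul K.continuous).integrable_of_hasCompactSupport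
      (HasCompactSupport.of_compactSpace _)
  have hK' : Integrable (fun s => φ s • K' s) m :=
    (φ.continuous.smul K'.continuous).integrable_of_hasCompactSupport
      (HasCompactSupport.of_compactSpace _)
  have e : ∫ t, g t • K t ∂m = ∫ s, φ s • K' s ∂m := by
    ext u
    rw [ContinuousMap.integral_apply hK, ContinuousMap.integral_apply hK',
      ← integral_mul_left_eq_self _ u]
    refine integral_congr_ae (Eventually.of_forall fun s => ?_)
    change g (u * s) * φ (u⁻¹ * (u * s)) = φ s * g (u * s)
    rw [inv_mul_cancel_left, mul_comm]
  calc ∫ t, g t • convMeasure μ (fun x => (φ x : ℂ)) t ∂m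
      = ∫ t, μ.integralCLM (g t • K t) ∂m := by
        refine integral_congr_ae (Eventually.of_forall fun t => ?_)
        exact (map_smul μ.integralCLM (g t) (K t)).symm
    _ = μ.integralCLM (∫ s, φ s • K' s ∂m) := by
        rw [ContinuousLinearMap.integral_comp_comm _ hK, e]
    _ = ∫ s, μ.integralCLM (φ s • K' s) ∂m :=
        (ContinuousLinearMap.integral_comp_comm _ hK').symm
    _ = _ := by
        refine integral_congr_ae (Eventually.of_forall fun s => ?_)
        exact map_smul μ.integralCLM (φ s) (K' s)

end Convolution

/-! ### Representable convolution operators -/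

section Representable

variable {G : Type*} [Group G] [TopologicalSpace G] [IsTopologicalGroup G] [CompactSpace G]
  [MeasurableSpace G] [BorelSpace G] {m : Measure G} [IsFiniteMeasure m] {Φ : YoungFunction}
  {μ : ComplexMeasure G} [IsFiniteMeasure μ.variation] {F : G → OrliczSpace Φ m}

open OrliczSpace

/-- If `F` represents `A ↦ μ * χ_A`, then it represents `φ ↦ μ * φ` for simple functions `φ`. The
measurability of `μ * φ` is part of the induction, as it is inherited from the integrals of `F`. -/
theorem convMeasure_simpleFunc (hF : Integrable F m)
    (hFμ : ∀ A : Set G, MeasurableSet A →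
      ⇑(∫ t in A, F t ∂m : OrliczSpace Φ m).1 =ᵐ[m] convMeasure μ (A.indicator 1))
    (g : C(G, ℝ)) (φ : SimpleFunc G ℝ) :
    AEStronglyMeasurable (convMeasure μ fun x => (φ x : ℂ)) m ∧
      ∫ s, φ s • pairing Φ m g (F s) ∂m =
        ∫ t, g t • convMeasure μ (fun x => (φ x : ℂ)) t ∂m := by
  have hT : Integrable (fun s => pairing Φ m g (F s)) m :=
    ContinuousLinearMap.integrable_comp (pairing Φ m g) hF
  have hbdd : ∀ ψ : SimpleFunc G ℝ, ∃ C : ℝ, ∀ x, |ψ x| ≤ C := fun ψ => by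
    simpa using ψ.exists_forall_norm_le
  induction φ using SimpleFunc.induction with
  | const c hA =>
    rename_i A
    have e : convMeasure μ (fun x => ((SimpleFunc.piecewise A hA (SimpleFunc.const G c)
        (SimpleFunc.const G 0) x : ℝ) : ℂ)) = fun t => c • convMeasure μ (A.indicator 1) t := by
      ext t
      rw [convMeasure, convMeasure, ← VectorMeasure.integral_fun_smul]
      congr 1
      ext u
      by_cases h : u⁻¹ * t ∈ A <;> simp [h]
    have hae := hFμ A hA
    rw [e]
    refine ⟨((AEEqFun.aestronglyMeasurable _).congr hae).const_smul c, ?_⟩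
    calc _ = ∫ s, A.indicator (fun s => c • pairing Φ m g (F s)) s ∂m := by
          refine integral_congr_ae (Eventually.of_forall fun s => ?_)
          by_cases h : s ∈ A <;> simp [h]
      _ = c • pairing Φ m g (∫ s in A, F s ∂m) := by
          rw [integral_indicator hA, integral_smul,
            ContinuousLinearMap.integral_comp_comm _ hF.integrableOn]
      _ = ∫ t, g t • c • convMeasure μ (A.indicator 1) t ∂m := by
          rw [pairing_apply, ← integral_smul]
          refine integral_congr_ae ?_
          filter_upwards [hae] with t ht
          rw [ht, smul_comm]
  | @add f f' _ hf hf' =>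
    obtain ⟨C, hC⟩ := hbdd f
    obtain ⟨C', hC'⟩ := hbdd f'
    have e : (convMeasure μ fun x => (((f + f') x : ℝ) : ℂ)) =
        (convMeasure μ fun x => (f x : ℂ)) + convMeasure μ fun x => (f' x : ℂ) := by
      ext t
      rw [Pi.add_apply, convMeasure, convMeasure, convMeasure, ← VectorMeasure.integral_fun_add
        (integrable_convMeasure_integrand μ f.measurable hC t)
        (integrable_convMeasure_integrand μ f'.measurable hC' t)]
      simp
    have hint : ∀ (ψ : SimpleFunc G ℝ), AEStronglyMeasurable (convMeasure μ fun x => (ψ x : ℂ)) m →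
        Integrable (fun t => g t • convMeasure μ (fun x => (ψ x : ℂ)) t) m := fun ψ hψ => by
      obtain ⟨D, hD⟩ := hbdd ψ
      exact (Integrable.of_bound hψ _ (Eventually.of_forall
        fun t => norm_convMeasure_le μ ψ.measurable hD t)).bdd_smul ‖g‖
        g.continuous.measurable.aestronglyMeasurable (Eventually.of_forall g.norm_coe_le_norm)
    have hint' : ∀ ψ : SimpleFunc G ℝ,
        Integrable (fun s => ψ s • pairing Φ m g (F s)) m := fun ψ => by
      obtain ⟨D, hD⟩ := hbdd ψ
      exact hT.bdd_smul D ψ.measurable.aestronglyMeasurable (Eventually.of_forall hD)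
    rw [e]
    refine ⟨hf.1.add hf'.1, ?_⟩
    simp only [SimpleFunc.coe_add, Pi.add_apply, add_smul, smul_add]
    rw [integral_add (hint' f) (hint' f'), integral_add (hint f hf.1) (hint f' hf'.1), hf.2, hf'.2]

theorem integral_smul_pairing_eq (hF : Integrable F m)
    (hFμ : ∀ A : Set G, MeasurableSet A →
      ⇑(∫ t in A, F t ∂m : OrliczSpace Φ m).1 =ᵐ[m] convMeasure μ (A.indicator 1))
    (g φ : C(G, ℝ)) :
    ∫ s, φ s • pairing Φ m g (F s) ∂m =
      ∫ t, g t • convMeasure μ (fun x => (φ x : ℂ)) t ∂m := by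
  have hT : Integrable (fun s => pairing Φ m g (F s)) m :=
    ContinuousLinearMap.integrable_comp (pairing Φ m g) hF
  have hφ : StronglyMeasurable φ := φ.continuous.measurable.stronglyMeasurable
  let ψ : ℕ → SimpleFunc G ℝ := hφ.approxBounded ‖φ‖
  have hψ : ∀ n x, |ψ n x| ≤ ‖φ‖ := fun n x => hφ.norm_approxBounded_le (norm_nonneg _) n x
  have hlim : ∀ x, Tendsto (fun n => ψ n x) atTop (𝓝 (φ x)) := fun x =>
    hφ.tendsto_approxBounded_of_norm_le (φ.norm_coe_le_norm x)
  have hleft : Tendsto (fun n => ∫ s, ψ n s • pairing Φ m g (F s) ∂m) atTop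
      (𝓝 (∫ s, φ s • pairing Φ m g (F s) ∂m)) := by
    refine tendsto_integral_of_dominated_convergence (fun s => ‖φ‖ * ‖pairing Φ m g (F s)‖)
      (fun n => (ψ n).measurable.aestronglyMeasurable.smul hT.1) (hT.norm.const_mul _)
      (fun n => Eventually.of_forall fun s => ?_)
      (Eventually.of_forall fun s => (hlim s).smul_const _)
    rw [norm_smul]
    gcongr
    exact hψ n s
  have hright : Tendsto (fun n => ∫ t, g t • convMeasure μ (fun x => (ψ n x : ℂ)) t ∂m) atTop
      (𝓝 (∫ t, g t • convMeasure μ (fun x => (φ x : ℂ)) t ∂m)) := by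
    refine tendsto_integral_of_dominated_convergence
      (fun _ => ‖g‖ * (‖ContinuousLinearMap.mul ℝ ℂ‖ * (μ.variation.real Set.univ * ‖φ‖)))
      (fun n => g.continuous.measurable.aestronglyMeasurable.smul
        (convMeasure_simpleFunc hF hFμ g (ψ n)).1) (integrable_const _)
      (fun n => Eventually.of_forall fun t => ?_) (Eventually.of_forall fun t =>
        (tendsto_convMeasure μ (fun n => (ψ n).measurable) hψ hlim t).const_smul _)
    rw [norm_smul]
    gcongr
    · exact g.norm_coe_le_norm t
    · exact norm_convMeasure_le μ (ψ n).measurable (hψ n) t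
  simp only [(convMeasure_simpleFunc hF hFμ g (ψ _)).2] at hleft
  exact tendsto_nhds_unique hleft hright

/-- For each continuous `g`, the pairing of `F s` with `g` is `∫ g(us) dμ(u)` for almost every `s`;
the exceptional null set may depend on `g`. -/
theorem pairing_ae_eq_integralCLM [T2Space G] [m.Regular] [m.IsMulLeftInvariant]
    (hF : Integrable F m)
    (hFμ : ∀ A : Set G, MeasurableSet A →
      ⇑(∫ t in A, F t ∂m : OrliczSpace Φ m).1 =ᵐ[m] convMeasure μ (A.indicator 1))
    (g : C(G, ℝ)) :
    ∀ᵐ s ∂m, pairing Φ m g (F s) = μ.integralCLM (g.comp (ContinuousMap.mulRight s)) := by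
  have hT : Integrable (fun s => pairing Φ m g (F s)) m :=
    ContinuousLinearMap.integrable_comp (pairing Φ m g) hF
  have hK : Continuous fun s : G => μ.integralCLM (g.comp (ContinuousMap.mulRight s)) :=
    μ.integralCLM.continuous.comp
      (ContinuousMap.curry ⟨fun p : G × G => g (p.2 * p.1), by fun_prop⟩).continuous
  have hKi : Integrable (fun s : G => μ.integralCLM (g.comp (ContinuousMap.mulRight s))) m :=
    hK.integrable_of_hasCompactSupport (HasCompactSupport.of_compactSpace _)
  have h0 := ae_eq_zero_of_forall_integral_continuousMap_smul_eq_zero (hT.sub hKi) fun φ => by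
    have h1 : Integrable (fun s => φ s • pairing Φ m g (F s)) m :=
      hT.bdd_smul ‖φ‖ φ.continuous.measurable.aestronglyMeasurable
        (Eventually.of_forall φ.norm_coe_le_norm)
    have h2 : Integrable
        (fun s => φ s • μ.integralCLM (g.comp (ContinuousMap.mulRight s))) m :=
      hKi.bdd_smul ‖φ‖ φ.continuous.measurable.aestronglyMeasurable
        (Eventually.of_forall φ.norm_coe_le_norm)
    simp only [Pi.sub_apply, smul_sub]
    rw [integral_sub h1 h2, integral_smul_pairing_eq hF hFμ, integral_smul_convMeasure, sub_self]
  filter_upwards [h0] with s hs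
  exact sub_eq_zero.1 hs

/-- An essential value `h` of `F` at `s₀` represents the right translate of `μ` by `s₀` on
continuous functions. Unlike in the almost everywhere identity, the pair `(s₀, h)` does not depend
on `g`, and no countability assumption on `G` is needed. -/
theorem exists_forall_pairing_eq_integralCLM [T2Space G] [m.Regular] [m.IsMulLeftInvariant]
    [NeZero m] (hF : Integrable F m)
    (hFμ : ∀ A : Set G, MeasurableSet A →
      ⇑(∫ t in A, F t ∂m : OrliczSpace Φ m).1 =ᵐ[m] convMeasure μ (A.indicator 1)) :
    ∃ (s₀ : G) (h : OrliczSpace Φ m), ∀ g : C(G, ℝ),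
      pairing Φ m g h = μ.integralCLM (g.comp (ContinuousMap.mulRight s₀)) := by
  obtain ⟨s₀, h, hne⟩ := exists_neBot_nhds_inf_ae_inf_comap hF.1
  refine ⟨s₀, h, fun g => ?_⟩
  have hK : Continuous fun s : G => μ.integralCLM (g.comp (ContinuousMap.mulRight s)) :=
    μ.integralCLM.continuous.comp
      (ContinuousMap.curry ⟨fun p : G × G => g (p.2 * p.1), by fun_prop⟩).continuous
  have h1 : Tendsto (fun s => pairing Φ m g (F s)) (𝓝 s₀ ⊓ (ae m ⊓ comap F (𝓝 h)))
      (𝓝 (pairing Φ m g h)) :=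
    ((pairing Φ m g).continuous.tendsto h).comp
      (tendsto_comap.mono_left (inf_le_right.trans inf_le_right))
  have h2 := (hK.tendsto s₀).mono_left
    (inf_le_left : 𝓝 s₀ ⊓ (ae m ⊓ comap F (𝓝 h)) ≤ 𝓝 s₀)
  have h3 := (pairing_ae_eq_integralCLM hF hFμ g).filter_mono
    (inf_le_right.trans inf_le_left : 𝓝 s₀ ⊓ (ae m ⊓ comap F (𝓝 h)) ≤ ae m)
  exact tendsto_nhds_unique (h1.congr' h3) h2

end Representable

/-! ### The density of the measure -/

/-- Compact groups are unimodular. -/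
theorem isMulRightInvariant_of_isProbabilityMeasure {G : Type*} [Group G] [TopologicalSpace G]
    [IsTopologicalGroup G] [CompactSpace G] [MeasurableSpace G] [BorelSpace G] (m : Measure G)
    [m.IsHaarMeasure] [IsProbabilityMeasure m] : m.IsMulRightInvariant := by
  refine ⟨fun s => ?_⟩
  have : IsProbabilityMeasure (m.map (· * s)) :=
    Measure.isProbabilityMeasure_map (measurable_mul_const s).aemeasurable
  exact Measure.isHaarMeasure_eq_of_isProbabilityMeasure _ _

theorem mainTheorem2 {G : Type*} [Group G] [TopologicalSpace G] [IsTopologicalGroup G]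
    [CompactSpace G] [T2Space G] [MeasurableSpace G] [BorelSpace G]
    (m : Measure G) [m.IsHaarMeasure] [m.Regular] [IsProbabilityMeasure m]
    (Φ Ψ : YoungFunction) (hΦΨ : Φ.IsComplementary Ψ) (hΦ : Φ.DeltaTwo) (hΨ : Ψ.DeltaTwo)
    (μ : ComplexMeasure G) (hμ : μ.variation.Regular)
    (F : G → OrliczSpace Φ m) (hF : Integrable F m)
    (hFμ : ∀ A : Set G, MeasurableSet A →
      ⇑(∫ t in A, F t ∂m : OrliczSpace Φ m).1 =ᵐ[m] convMeasure μ (A.indicator 1)) :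
    ∃ f : OrliczSpace Φ m, Integrable (⇑f.1) m ∧
      ∀ A : Set G, MeasurableSet A → μ A = ∫ x in A, f.1 x ∂m := by
  have : IsFiniteMeasure μ.variation := ⟨isCompact_univ.measure_lt_top⟩
  have := isMulRightInvariant_of_isProbabilityMeasure m
  obtain ⟨s₀, h, hh⟩ := exists_forall_pairing_eq_integralCLM hF hFμ
  obtain ⟨f, hf⟩ := OrliczSpace.exists_coeFn_ae_eq_comp (measurePreserving_mul_right m s₀) h
  refine ⟨f, (OrliczSpace.integrable f), fun A hA => ?_⟩
  have key : ∀ g : C(G, ℝ), ∫ x, g x • f.1 x ∂m = μ.integralCLM g := fun g => by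
    have h1 := hh (g.comp (ContinuousMap.mulRight s₀⁻¹))
    rw [OrliczSpace.pairing_apply, ← integral_mul_right_eq_self _ s₀] at h1
    have e : (g.comp (ContinuousMap.mulRight s₀⁻¹)).comp (ContinuousMap.mulRight s₀) = g := by
      ext x; simp
    rw [e] at h1
    rw [← h1]
    refine integral_congr_ae ?_
    filter_upwards [hf] with x hx
    simp [hx]
  -- One sequence of continuous functions has to converge to `χ_A` for both measures.
  obtain ⟨g, hg, hlim⟩ := exists_continuousMap_tendsto_indicator (μ.variation + m) hA
  have hlim' := ae_add_measure_iff.1 hlim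
  have h1 := tendsto_integralCLM_of_abs_le_one μ hA hg hlim'.1
  have h2 := tendsto_integral_smul_of_abs_le_one (OrliczSpace.integrable f) hA hg hlim'.2
  simp only [key] at h2
  exact tendsto_nhds_unique h1 h2
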